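/- Let $\Gamma$ be a rooted metric tree with root $o$, write $|x|$ for the distance of a point $x$ from $o$, $\Gamma_o=\Gamma\cup\{o\}$, and let the branching number of a vertex be the number of edges emanating from it (away from the root); it is finite at every vertex, equal to $1$ at $o$ and greater than $1$ at every other vertex. Assume that $\Gamma$ is regular, i.e. all vertices at the same distance from $o$ have equal branching numbers and all edges emanating from these vertices have equal length; that $\Gamma$ has infinite height, $\sup_{x\in\Gamma}|x|=\infty$; and that, with $g_0(t)=\#\{x\in\Gamma:|x|=t\}$, it has finite reduced height, $$\int_0^\infty \frac{dt}{g_0(t)}<\infty .$$ Let $\psi$ be a measurable, non-negative function on $\mathbb{R}_+$. Let $C_0^\infty(\Gamma_o)$ be the class of (real- or complex-valued) functions $u$ on $\Gamma_o$ that are continuous on $\Gamma_o$, infinitely smooth up to the end points on each closed edge, and have bounded support in $\Gamma_o$; no condition is imposed at the root. For a constant $0\le C<\infty$ consider the Hardy inequality $$\int_\Gamma \psi(|x|)\,|u(x)|^2\,dx\le C\int_\Gamma |u'(x)|^2\,dx\qquad\text{for all } u\in C_0^\infty(\Gamma_o). \tag{1}$$ Then (1) holds with some constant $C<\infty$ if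 and only if $$M(\Gamma,\psi):=\sup_{t>0}\left(\int_0^t\psi(s)\,g_0(s)\,ds\right)\left(\int_t^\infty\frac{ds}{g_0(s)}\right)<\infty .$$ In that case there is a smallest constant $C(\Gamma,\psi)$ for which (1) holds, and it satisfies $$M(\Gamma,\psi)\le C(\Gamma,\psi)\le 4\,M(\Gamma,\psi).$$ -/

import Mathlib

open Set MeasureTheory
open scoped ENNReal NNReal ContDiff

universe u

/-- A rooted metric tree: a combinatorial rooted tree (root `⊥`, parent map `Order.pred`) in which
every vertex `v ≠ ⊥` carries the length of the edge joining `Order.pred v` to `v`. -/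
structure RootedMetricTree where
  /-- the combinatorial rooted tree of vertices -/
  tree : RootedTree.{u}
  /-- `length v` is the length of the edge from `Order.pred v` to `v`
  (the value at the root is irrelevant) -/
  length : tree → ℝ
  length_pos : ∀ v : tree, v ≠ ⊥ → 0 < length v

namespace RootedMetricTree

variable (G : RootedMetricTree.{u})

/-- The distance `|v|` of a vertex from the root: the sum of the lengths of the edges on the path
from the root to `v`. -/
noncomputable def height (v : G.tree) : ℝ :=
  ∑ᶠ w ∈ Set.Ioc (⊥ : G.tree) v, G.length w

theorem finite_Ioc_bot (v : G.tree) : (Set.Ioc (⊥ : G.tree) v).Finite := by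
  obtain ⟨n, hn⟩ := (bot_le (a := v)).exists_pred_iterate
  refine ((Set.finite_Iic n).image fun i => Order.pred^[i] v).subset ?_
  rintro w ⟨hw0, hwv⟩
  obtain ⟨i, rfl⟩ := hwv.exists_pred_iterate
  refine ⟨i, ?_, rfl⟩
  by_contra hi
  simp only [Set.mem_Iic, not_le] at hi
  have h : Order.pred^[i] v = ⊥ := by
    obtain ⟨k, rfl⟩ := Nat.exists_eq_add_of_lt hi
    rw [show n + k + 1 = (k + 1) + n by ring, Function.iterate_add_apply, hn]
    exact Function.iterate_fixed (by simp) _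
  exact hw0.ne' h

theorem height_bot : G.height ⊥ = 0 := by simp [height]

theorem height_eq (v : G.tree) (hv : v ≠ ⊥) :
    G.height v = G.height (Order.pred v) + G.length v := by
  have hlt : Order.pred v < v :=
    Order.pred_lt_of_not_isMin fun h => hv (isMin_iff_eq_bot.1 h)
  have hset : Set.Ioc (⊥ : G.tree) v = insert v (Set.Ioc ⊥ (Order.pred v)) := by
    ext w
    simp only [Set.mem_Ioc, Set.mem_insert_iff]
    constructor
    · rintro ⟨h0, h1⟩
      rcases eq_or_lt_of_le h1 with h | h
      · exact Or.inl h
      · exact Or.inr ⟨h0, Order.le_pred_of_lt h⟩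
    · rintro (rfl | ⟨h0, h1⟩)
      · exact ⟨bot_lt_iff_ne_bot.2 hv, le_rfl⟩
      · exact ⟨h0, h1.trans hlt.le⟩
  rw [height, hset, finsum_mem_insert _ (fun h => absurd h.2 hlt.not_ge)
    (G.finite_Ioc_bot _), height, add_comm]

theorem height_pred_lt (v : G.tree) (hv : v ≠ ⊥) : G.height (Order.pred v) < G.height v := by
  rw [G.height_eq v hv]
  linarith [G.length_pos v hv]

/-- The points of the metric tree including its root, i.e. of `Γ ∪ {o}`. The root is `(⊥, 0)`;
the pair `(v, t)` with `v ≠ ⊥` and `|pred v| < t ≤ |v|` is the point at distance `t` from the root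
on the edge joining `pred v` to `v` (this edge includes its upper end `v` but not its lower end
`pred v`), so that each point other than the root is represented exactly once. -/
def Point : Type _ :=
  {p : G.tree × ℝ //
    p = (⊥, 0) ∨ p.1 ≠ ⊥ ∧ p.2 ∈ Set.Ioc (G.height (Order.pred p.1)) (G.height p.1)}

variable {G}

/-- The distance `|x|` of a point from the root. -/
def Point.dist (x : G.Point) : ℝ := x.1.2

variable (G)

/-- A vertex, regarded as a point of the metric tree. -/
noncomputable def vertexPoint (v : G.tree) : G.Point :=
  ⟨(v, G.height v), by
    rcases eq_or_ne v ⊥ with rfl | hv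
    · left
      rw [G.height_bot]
    · right
      exact ⟨hv, G.height_pred_lt v hv, le_rfl⟩⟩

/-- The edges of the tree, each given by its upper end (the end further away from the root). -/
abbrev Edge : Type _ := {v : G.tree // v ≠ ⊥}

/-- The interval of distances from the root covered by the closed edge with upper end `v`. -/
def edgeIcc (v : G.tree) : Set ℝ := Set.Icc (G.height (Order.pred v)) (G.height v)

/-- The interval of distances from the root covered by the edge with upper end `v`,
without its lower end. -/
def edgeIoc (v : G.tree) : Set ℝ := Set.Ioc (G.height (Order.pred v)) (G.height v)

variable {G}

open Classical in
/-- The restriction of a function on the tree to the closed edge with upper end `v`, written as a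
function of the distance `t` from the root; at the lower end of the edge it is the value at the
vertex `pred v`. Only its values for `t ∈ G.edgeIcc v` are meaningful. -/
noncomputable def onEdge {α : Type*} (u : G.Point → α) (v : G.Edge) (t : ℝ) : α :=
  if h : t ∈ G.edgeIoc v.1 then u ⟨(v.1, t), Or.inr ⟨v.2, h⟩⟩
  else u (G.vertexPoint (Order.pred v.1))

/-- The integral over the tree of a function with values in `[0, ∞]`: the sum over all edges of the
one-dimensional Lebesgue integrals. -/
noncomputable def treeIntegral (F : G.Point → ℝ≥0∞) : ℝ≥0∞ :=
  ∑' v : G.Edge, ∫⁻ t in G.edgeIoc v.1, onEdge F v t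

open Classical in
/-- The derivative `u'` along the edges, in the direction away from the root. At a vertex it is the
one-sided derivative along the edge that ends there; the value at the root is set to `0`. -/
noncomputable def treeDeriv {𝕜 : Type*} [RCLike 𝕜] (u : G.Point → 𝕜) (x : G.Point) : 𝕜 :=
  if hx : x.1.1 ≠ ⊥ then
    derivWithin (onEdge u ⟨x.1.1, hx⟩) (G.edgeIcc x.1.1) x.dist
  else 0

/-- The class `C₀^∞(Γ ∪ {o})`: on every closed edge `u` is infinitely smooth up to both ends, and
the support of `u` is bounded. Continuity at the vertices is contained in this, since the
restrictions of `u` to the closed edges that meet in a vertex take there the common value of `u`.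
Nothing is required at the root. -/
structure IsSmoothBounded {𝕜 : Type*} [RCLike 𝕜] (u : G.Point → 𝕜) : Prop where
  smooth : ∀ v : G.Edge, ContDiffOn ℝ ∞ (onEdge u v) (G.edgeIcc v.1)
  bounded_support : ∃ R : ℝ, ∀ x : G.Point, u x ≠ 0 → x.dist ≤ R

variable (G)

/-- The set of vertices joined to `v` by the edges emanating from `v`. -/
def children (v : G.tree) : Set G.tree := {w | w ≠ ⊥ ∧ Order.pred w = v}

/-- The branching number `b(v)`: the number of edges emanating from `v`. -/
noncomputable def branching (v : G.tree) : ℕ∞ := (G.children v).encard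

/-- A regular tree: branching numbers are finite, equal to `1` at the root and greater than `1` at
every other vertex; and vertices at the same distance from the root have equal branching numbers,
while all the edges emanating from these vertices have equal length. -/
structure IsRegular : Prop where
  branching_lt_top : ∀ v, G.branching v < ⊤
  branching_root : G.branching ⊥ = 1
  one_lt_branching : ∀ v, v ≠ ⊥ → 1 < G.branching v
  branching_eq : ∀ v w, G.height v = G.height w → G.branching v = G.branching w
  length_eq : ∀ v w, G.height v = G.height w →
    ∀ v' ∈ G.children v, ∀ w' ∈ G.children w, G.length v' = G.length w'

/-- The tree has infinite height: `sup |x| = ∞`. -/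
def InfiniteHeight : Prop := ¬ BddAbove (Set.range fun x : G.Point => x.dist)

/-- The branching function `g₀(t) = #{x : |x| = t}`. -/
noncomputable def g₀ (t : ℝ) : ℝ≥0∞ := (({x : G.Point | x.dist = t}.encard : ℕ∞) : ℝ≥0∞)

/-- The reduced height `∫_0^∞ dt / g₀(t)`. -/
noncomputable def reducedHeight : ℝ≥0∞ := ∫⁻ t in Set.Ioi (0 : ℝ), (G.g₀ t)⁻¹

/-- `M(Γ, ψ) = sup_{t > 0} (∫_0^t ψ g₀ ds) (∫_t^∞ ds / g₀)`, an element of `[0, ∞]`. -/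
noncomputable def M (ψ : ℝ → ℝ) : ℝ≥0∞ :=
  ⨆ t ∈ Set.Ioi (0 : ℝ), (∫⁻ s in Set.Ioc 0 t, ENNReal.ofReal (ψ s) * G.g₀ s) *
    ∫⁻ s in Set.Ioi t, (G.g₀ s)⁻¹

/-- The Hardy inequality `∫_Γ ψ(|x|) |u|² dx ≤ C ∫_Γ |u'|² dx` for all `𝕜`-valued
`u ∈ C₀^∞(Γ ∪ {o})`, with the constant `C`. -/
def HardyInequality (𝕜 : Type*) [RCLike 𝕜] (ψ : ℝ → ℝ) (C : ℝ≥0) : Prop :=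
  ∀ u : G.Point → 𝕜, IsSmoothBounded u →
    treeIntegral (fun x => ENNReal.ofReal (ψ x.dist) * ‖u x‖ₑ ^ 2) ≤
      (C : ℝ≥0∞) * treeIntegral (fun x => ‖treeDeriv u x‖ₑ ^ 2)

end RootedMetricTree

/-- Tonelli's theorem on the triangle `0 < t < s`. -/
theorem lintegral_mul_setLIntegral_Ioi {a b : ℝ → ℝ≥0∞}
    (ha : AEMeasurable a (volume.restrict (Ioi 0)))
    (hb : AEMeasurable b (volume.restrict (Ioi 0))) :
    ∫⁻ t in Ioi (0 : ℝ), a t * ∫⁻ s in Ioi t, b s =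
      ∫⁻ s in Ioi (0 : ℝ), b s * ∫⁻ t in Ioc 0 s, a t := by
  set μ := volume.restrict (Ioi (0 : ℝ)) with hμ
  have hm : MeasurableSet {p : ℝ × ℝ | p.1 < p.2} := measurableSet_lt measurable_fst measurable_snd
  have hmeas : AEMeasurable (Function.uncurry fun t s : ℝ =>
      {p : ℝ × ℝ | p.1 < p.2}.indicator (fun p => a p.1 * b p.2) (t, s)) (μ.prod μ) :=
    ((ha.comp_fst (ν := μ)).mul (hb.comp_snd (μ := μ))).indicator hm
  have key := lintegral_lintegral_swap hmeas
  calc ∫⁻ t, (a t * ∫⁻ s in Ioi t, b s) ∂μ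
      = ∫⁻ t, ∫⁻ s, {p : ℝ × ℝ | p.1 < p.2}.indicator (fun p => a p.1 * b p.2) (t, s) ∂μ ∂μ := by
        refine setLIntegral_congr_fun measurableSet_Ioi fun t (ht : 0 < t) => ?_
        have h1 : ∀ s, {p : ℝ × ℝ | p.1 < p.2}.indicator (fun p => a p.1 * b p.2) (t, s) =
            (Ioi t).indicator (fun s => a t * b s) s := fun s => rfl
        simp_rw [h1]
        rw [lintegral_indicator measurableSet_Ioi, hμ, Measure.restrict_restrict measurableSet_Ioi,
          inter_eq_left.2 (Ioi_subset_Ioi ht.le), lintegral_const_mul'']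
        exact hb.mono_measure (Measure.restrict_mono (Ioi_subset_Ioi ht.le) le_rfl)
    _ = _ := key
    _ = _ := by
        refine setLIntegral_congr_fun measurableSet_Ioi fun s (hs : 0 < s) => ?_
        have h1 : ∀ t, {p : ℝ × ℝ | p.1 < p.2}.indicator (fun p => a p.1 * b p.2) (t, s) =
            (Iio s).indicator (fun t => b s * a t) t := fun t => by
          simp only [indicator, mem_ofPred_eq, mem_Iio, mul_comm]
        simp_rw [h1]
        rw [lintegral_indicator measurableSet_Iio, hμ, Measure.restrict_restrict measurableSet_Iio,
          inter_comm, Ioi_inter_Iio, restrict_Ioo_eq_restrict_Ioc, lintegral_const_mul'']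
        exact ha.mono_measure (Measure.restrict_mono Ioc_subset_Ioi_self le_rfl)

/-- If `Φ t = ∫_t^∞ h`, then `∫_0^s h / Φ² ≤ 1 / Φ s`. -/
theorem setLIntegral_mul_inv_sq_le {h : ℝ → ℝ≥0∞}
    (hm : AEMeasurable h (volume.restrict (Ioi 0))) (hfin : ∫⁻ t in Ioi (0 : ℝ), h t ≠ ⊤)
    {s : ℝ} (hs : 0 < s) (hΦ : ∫⁻ t in Ioi s, h t ≠ 0) :
    ∫⁻ t in Ioc 0 s, h t * ((∫⁻ r in Ioi t, h r)⁻¹) ^ 2 ≤ (∫⁻ r in Ioi s, h r)⁻¹ := by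
  set Φ : ℝ → ℝ≥0∞ := fun t => ∫⁻ r in Ioi t, h r with hΦdef
  set k : ℝ → ℝ := fun t => (h t).toReal with hk
  have hmono : ∀ {a b : ℝ}, a ≤ b → Φ b ≤ Φ a := fun hab =>
    lintegral_mono_set (Ioi_subset_Ioi hab)
  have hΦfin : ∀ t, 0 ≤ t → Φ t ≠ ⊤ := fun t ht => ((hmono ht).trans_lt hfin.lt_top).ne
  have hΦpos : ∀ t, t ≤ s → Φ t ≠ 0 := fun t ht h0 => hΦ (le_antisymm (h0 ▸ hmono ht) bot_le)
  have hae : ∀ᵐ t ∂volume.restrict (Ioi (0 : ℝ)), h t < ⊤ := ae_lt_top' hm hfin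
  have hint : IntegrableOn k (Ioi 0) := integrable_toReal_of_lintegral_ne_top hm hfin
  have hII : ∀ {a b : ℝ}, 0 ≤ a → a ≤ b → IntervalIntegrable k volume a b := fun ha hab =>
    (intervalIntegrable_iff_integrableOn_Ioc_of_le hab).2
      (hint.mono_set fun x hx => lt_of_le_of_lt ha hx.1)
  have hφ : ∀ t, 0 ≤ t → (Φ t).toReal = (Φ 0).toReal - ∫ r in (0 : ℝ)..t, k r := by
    intro t ht
    have h1 : Φ 0 = (∫⁻ r in Ioc 0 t, h r) + Φ t := by
      simp only [hΦdef]
      rw [← Ioc_union_Ioi_eq_Ioi ht, lintegral_union measurableSet_Ioi]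
      exact Set.disjoint_left.2 fun x hx hx' => not_lt_of_ge hx.2 hx'
    have h2 : ∫⁻ r in Ioc 0 t, h r ≠ ⊤ := fun h => hΦfin 0 le_rfl (by rw [h1, h, top_add])
    have h3 : ∫ r in (0 : ℝ)..t, k r = (∫⁻ r in Ioc 0 t, h r).toReal := by
      rw [intervalIntegral.integral_of_le ht]
      refine integral_toReal (hm.mono_measure (Measure.restrict_mono Ioc_subset_Ioi_self le_rfl)) ?_
      exact ae_mono (Measure.restrict_mono Ioc_subset_Ioi_self le_rfl) hae
    rw [h3, h1, ENNReal.toReal_add h2 (hΦfin t ht)]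
    ring
  set G : ℝ → ℝ := fun t => ((Φ 0).toReal - ∫ r in (0 : ℝ)..t, k r)⁻¹ with hG
  have hGeq : ∀ t, 0 ≤ t → G t = ((Φ t).toReal)⁻¹ := fun t ht => by rw [hG, hφ t ht]
  have hGmono : MonotoneOn G (uIcc 0 s) := by
    rw [uIcc_of_le hs.le]
    intro a ha b hb hab
    rw [hGeq a ha.1, hGeq b hb.1]
    exact inv_anti₀ (ENNReal.toReal_pos (hΦpos b hb.2) (hΦfin b hb.1))
      (ENNReal.toReal_mono (hΦfin a ha.1) (hmono hab))
  have hderiv : ∀ᵐ t ∂volume.restrict (Ioc 0 s),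
      h t * ((Φ t)⁻¹) ^ 2 = ENNReal.ofReal (deriv G t) := by
    have h1 := (hII le_rfl hs.le).ae_hasDerivAt_integral
    rw [uIcc_of_le hs.le] at h1
    have h2 : ∀ᵐ t ∂volume.restrict (Ioc 0 s), h t < ⊤ :=
      ae_mono (Measure.restrict_mono Ioc_subset_Ioi_self le_rfl) hae
    filter_upwards [ae_restrict_of_ae h1, h2, ae_restrict_mem measurableSet_Ioc] with t ht1 ht2 ht
    have hd := ht1 ⟨ht.1.le, ht.2⟩ 0 ⟨le_rfl, hs.le⟩
    have hp : 0 < (Φ t).toReal := ENNReal.toReal_pos (hΦpos t ht.2) (hΦfin t ht.1.le)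
    have hd' := ((hd.const_sub (Φ 0).toReal).inv (by rw [← hφ t ht.1.le]; exact hp.ne')).deriv
    change deriv G t = _ at hd'
    rw [hd', ← hφ t ht.1.le, neg_neg, ENNReal.ofReal_div_of_pos (by positivity),
      ENNReal.ofReal_toReal ht2.ne, ENNReal.ofReal_pow hp.le,
      ENNReal.ofReal_toReal (hΦfin t ht.1.le), div_eq_mul_inv, ENNReal.inv_pow]
  rw [lintegral_congr_ae hderiv, ← ofReal_integral_eq_lintegral_ofReal]
  · rw [← intervalIntegral.integral_of_le hs.le]
    have h1 := hGmono.intervalIntegral_deriv_mem_uIcc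
    have h2 : G 0 ≤ G s := hGmono left_mem_uIcc right_mem_uIcc hs.le
    rw [uIcc_of_le (sub_nonneg.2 h2)] at h1
    have h3 : 0 ≤ G 0 := by rw [hGeq 0 le_rfl]; positivity
    calc _ ≤ ENNReal.ofReal (G s) := ENNReal.ofReal_le_ofReal (by linarith [h1.2])
      _ = (Φ s)⁻¹ := by
        rw [hGeq s hs.le, ENNReal.ofReal_inv_of_pos
          (ENNReal.toReal_pos (hΦpos s le_rfl) (hΦfin s hs.le)),
          ENNReal.ofReal_toReal (hΦfin s hs.le)]
  · exact ((intervalIntegrable_iff_integrableOn_Ioc_of_le hs.le).1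
      hGmono.intervalIntegrable_deriv)
  · have h0 : ∀ᵐ t ∂(volume : Measure ℝ), t ≠ s := by simp [ae_iff]
    filter_upwards [ae_restrict_of_ae h0, ae_restrict_mem measurableSet_Ioc] with t ht0 ht
    have hmem : uIcc 0 s ∈ nhds t := by
      rw [uIcc_of_le hs.le]
      exact Icc_mem_nhds ht.1 (lt_of_le_of_ne ht.2 ht0)
    rw [Pi.zero_apply, ← derivWithin_of_mem_nhds hmem]
    exact hGmono.derivWithin_nonneg

/-- A one-dimensional weighted Hardy inequality with the constant `4 * M`. -/
theorem lintegral_mul_le_of_muckenhoupt {h w P Q R : ℝ → ℝ≥0∞} {M : ℝ≥0∞}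
    (hh : AEMeasurable h (volume.restrict (Ioi 0)))
    (hw : AEMeasurable w (volume.restrict (Ioi 0)))
    (hP : AEMeasurable P (volume.restrict (Ioi 0)))
    (hQ : AEMeasurable Q (volume.restrict (Ioi 0)))
    (hfin : ∫⁻ t in Ioi (0 : ℝ), h t ≠ ⊤)
    (hpos : ∀ s : ℝ, 0 < s → ∫⁻ t in Ioi s, h t ≠ 0)
    (hQP : ∀ t : ℝ, 0 < t → h t * Q t ≤ ∫⁻ s in Ioi t, 2 * P s * h s)
    (hPQR : ∀ t : ℝ, 0 < t → ∀ c, 2 * P t * c ≤ 2⁻¹ * (Q t * c ^ 2) + 2 * R t)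
    (hX : ∫⁻ t in Ioi (0 : ℝ), Q t * (h t * (∫⁻ r in Ioi t, h r)⁻¹) ^ 2 ≠ ⊤)
    (hM : ∀ t : ℝ, 0 < t → (∫⁻ s in Ioc 0 t, w s) * ∫⁻ s in Ioi t, h s ≤ M) :
    ∫⁻ t in Ioi (0 : ℝ), w t * (h t * Q t) ≤ 4 * M * ∫⁻ t in Ioi (0 : ℝ), R t := by
  set Φ : ℝ → ℝ≥0∞ := fun t => ∫⁻ r in Ioi t, h r with hΦdef
  set X := ∫⁻ t in Ioi (0 : ℝ), Q t * (h t * (Φ t)⁻¹) ^ 2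
  set Z := ∫⁻ t in Ioi (0 : ℝ), 2 * P t * h t * (Φ t)⁻¹
  set D := ∫⁻ t in Ioi (0 : ℝ), R t
  have hΦm : Measurable Φ :=
    Antitone.measurable fun a b hab => lintegral_mono_set (Ioi_subset_Ioi hab)
  have hΦfin : ∀ t, 0 < t → Φ t ≠ ⊤ := fun t ht =>
    ((lintegral_mono_set (Ioi_subset_Ioi ht.le)).trans_lt hfin.lt_top).ne
  have hPh : AEMeasurable (fun s => 2 * P s * h s) (volume.restrict (Ioi 0)) :=
    (hP.const_mul 2).mul hh
  have hXZ : X ≤ Z := by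
    calc X ≤ ∫⁻ t in Ioi (0 : ℝ), (h t * ((Φ t)⁻¹) ^ 2) * ∫⁻ s in Ioi t, 2 * P s * h s := by
          refine setLIntegral_mono' measurableSet_Ioi fun t ht => ?_
          calc _ = (h t * ((Φ t)⁻¹) ^ 2) * (h t * Q t) := by ring
            _ ≤ _ := mul_le_mul_right (hQP t ht) _
      _ = ∫⁻ s in Ioi (0 : ℝ), (2 * P s * h s) * ∫⁻ t in Ioc 0 s, h t * ((Φ t)⁻¹) ^ 2 :=
          lintegral_mul_setLIntegral_Ioi (hh.mul (hΦm.inv.pow_const 2).aemeasurable) hPh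
      _ ≤ Z := setLIntegral_mono' measurableSet_Ioi fun s hs =>
          mul_le_mul_right (setLIntegral_mul_inv_sq_le hh hfin hs (hpos s hs)) _
  have hZX : Z ≤ 2⁻¹ * X + 2 * D := by
    calc Z ≤ ∫⁻ t in Ioi (0 : ℝ), (2⁻¹ * (Q t * (h t * (Φ t)⁻¹) ^ 2) + 2 * R t) :=
          setLIntegral_mono' measurableSet_Ioi fun t ht => by
            rw [mul_assoc]; exact hPQR t ht _
      _ = _ := by
        have hm : AEMeasurable (fun t => 2⁻¹ * (Q t * (h t * (Φ t)⁻¹) ^ 2))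
            (volume.restrict (Ioi 0)) :=
          (hQ.mul ((hh.mul hΦm.inv.aemeasurable).pow_const 2)).const_mul _
        rw [lintegral_add_left' hm, lintegral_const_mul' _ _ (by simp),
          lintegral_const_mul' _ _ (by simp)]
  have hZD : Z ≤ 4 * D := by
    have h1 : X ≤ 2⁻¹ * X + 2 * D := hXZ.trans hZX
    have h2 : (2⁻¹ : ℝ≥0∞) * X + 2⁻¹ * X = X := by
      rw [← add_mul, ENNReal.inv_two_add_inv_two, one_mul]
    have h3 : 2⁻¹ * X ≤ 2 * D := by
      exact (ENNReal.add_le_add_iff_left (ENNReal.mul_ne_top (by simp) hX)).1 (h2.trans_le h1)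
    calc Z ≤ 2 * D + 2 * D := hZX.trans (by gcongr)
      _ = 4 * D := by ring
  calc ∫⁻ t in Ioi (0 : ℝ), w t * (h t * Q t)
      ≤ ∫⁻ t in Ioi (0 : ℝ), w t * ∫⁻ s in Ioi t, 2 * P s * h s :=
        setLIntegral_mono' measurableSet_Ioi fun t ht => mul_le_mul_right (hQP t ht) _
    _ = ∫⁻ s in Ioi (0 : ℝ), (2 * P s * h s) * ∫⁻ t in Ioc 0 s, w t :=
        lintegral_mul_setLIntegral_Ioi hw hPh
    _ ≤ ∫⁻ s in Ioi (0 : ℝ), M * (2 * P s * h s * (Φ s)⁻¹) := by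
        refine setLIntegral_mono' measurableSet_Ioi fun s hs => ?_
        have h1 : ∫⁻ t in Ioc 0 s, w t ≤ M * (Φ s)⁻¹ := by
          rw [← div_eq_mul_inv]
          exact (ENNReal.le_div_iff_mul_le (Or.inl (hpos s hs)) (Or.inl (hΦfin s hs))).2 (hM s hs)
        calc _ ≤ (2 * P s * h s) * (M * (Φ s)⁻¹) := mul_le_mul_right h1 _
          _ = _ := by ring
    _ = M * Z := lintegral_const_mul'' _ (hPh.mul hΦm.inv.aemeasurable)
    _ ≤ M * (4 * D) := by gcongr
    _ = 4 * M * D := by ring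

/-- A bound for the squared norm of a smooth function by its value at the right end point. -/
theorem enorm_sq_le_add_setLIntegral {𝕜 : Type*} [RCLike 𝕜] {f : ℝ → 𝕜} {a b t : ℝ}
    (hf : ContDiffOn ℝ ∞ f (Icc a b)) (hab : a < b) (ht : t ∈ Icc a b) :
    ‖f t‖ₑ ^ 2 ≤ ‖f b‖ₑ ^ 2 +
      ∫⁻ s in Ioc t b, 2 * (‖f s‖ₑ * ‖derivWithin f (Icc a b) s‖ₑ) := by
  have hcd : ContinuousOn (derivWithin f (Icc a b)) (Icc a b) :=
    hf.continuousOn_derivWithin (uniqueDiffOn_Icc hab) (by simp)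
  have hsub : Icc t b ⊆ Icc a b := Icc_subset_Icc_left ht.1
  have hc := hf.continuousOn
  set F : ℝ → ℝ := fun s => 2 * (‖f s‖ * ‖derivWithin f (Icc a b) s‖) with hF
  have hFc : ContinuousOn F (Icc t b) :=
    ((hc.norm.mul hcd.norm).const_smul (2 : ℝ)).mono hsub
  have hFi : IntegrableOn F (Icc t b) := hFc.integrableOn_Icc
  have hIc : ContinuousOn (fun s => 2 * inner ℝ (f s) (derivWithin f (Icc a b) s)) (Icc t b) :=
    ((hc.inner hcd).const_smul (2 : ℝ)).mono hsub
  have h1 : ∫ s in t..b, 2 * inner ℝ (f s) (derivWithin f (Icc a b) s) =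
      ‖f b‖ ^ 2 - ‖f t‖ ^ 2 := by
    refine intervalIntegral.integral_eq_sub_of_hasDerivAt_of_le (f := fun s => ‖f s‖ ^ 2) ht.2
      ((hc.norm.pow 2).mono hsub) (fun x hx => ?_)
      (hIc.intervalIntegrable_of_Icc ht.2)
    have hx' : x ∈ Ioo a b := ⟨ht.1.trans_lt hx.1, hx.2⟩
    have hd : HasDerivWithinAt f (derivWithin f (Icc a b) x) (Icc a b) x :=
      ((hf.differentiableOn (by simp)) x (Ioo_subset_Icc_self hx')).hasDerivWithinAt
    exact (hd.hasDerivAt (Icc_mem_nhds hx'.1 hx'.2)).norm_sq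
  have h2 : -∫ s in t..b, F s ≤ ∫ s in t..b, 2 * inner ℝ (f s) (derivWithin f (Icc a b) s) := by
    rw [← intervalIntegral.integral_neg]
    refine intervalIntegral.integral_mono_on ht.2
      (hFc.intervalIntegrable_of_Icc ht.2).neg (hIc.intervalIntegrable_of_Icc ht.2) fun x _ => ?_
    have := (abs_le.1 (abs_real_inner_le_norm (f x) (derivWithin f (Icc a b) x))).1
    simp only [hF]
    linarith
  have h3 : ∫⁻ s in Ioc t b, 2 * (‖f s‖ₑ * ‖derivWithin f (Icc a b) s‖ₑ) =
      ENNReal.ofReal (∫ s in t..b, F s) := by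
    rw [intervalIntegral.integral_of_le ht.2, ofReal_integral_eq_lintegral_ofReal
      (hFi.mono_set Ioc_subset_Icc_self) (Filter.Eventually.of_forall fun x => by
        simp only [hF, Pi.zero_apply]; positivity)]
    refine lintegral_congr fun s => ?_
    simp only [hF]
    rw [ENNReal.ofReal_mul (by norm_num), ENNReal.ofReal_mul (norm_nonneg _), ofReal_norm,
      ofReal_norm, ENNReal.ofReal_ofNat]
  rw [h3, ← ofReal_norm, ← ofReal_norm, ← ENNReal.ofReal_pow (norm_nonneg _),
    ← ENNReal.ofReal_pow (norm_nonneg _), ← ENNReal.ofReal_add (by positivity)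
    (intervalIntegral.integral_nonneg ht.2 fun x _ => by simp only [hF]; positivity)]
  exact ENNReal.ofReal_le_ofReal (by linarith)

namespace RootedMetricTree

variable {G : RootedMetricTree.{u}}

/-- The vertices of a given generation. -/
def generation (G : RootedMetricTree.{u}) : ℕ → Set G.tree
  | 0 => {⊥}
  | n + 1 => {w | w ≠ ⊥ ∧ Order.pred w ∈ generation G n}

theorem exists_mem_generation (v : G.tree) : ∃ n, v ∈ G.generation n := by
  obtain ⟨n, hn⟩ := (bot_le (a := v)).exists_pred_iterate
  induction n generalizing v with
  | zero => exact ⟨0, hn⟩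
  | succ n ih =>
    rcases eq_or_ne v ⊥ with rfl | hv
    · exact ⟨0, rfl⟩
    · obtain ⟨m, hm⟩ := ih (Order.pred v) hn
      exact ⟨m + 1, hv, hm⟩

theorem IsRegular.children_nonempty (hreg : G.IsRegular) (v : G.tree) :
    (G.children v).Nonempty := by
  rw [← Set.one_le_encard_iff_nonempty]
  rcases eq_or_ne v ⊥ with rfl | hv
  · exact hreg.branching_root.ge
  · exact (hreg.one_lt_branching v hv).le

theorem IsRegular.children_finite (hreg : G.IsRegular) (v : G.tree) : (G.children v).Finite :=
  Set.encard_lt_top_iff.1 (hreg.branching_lt_top v)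

theorem IsRegular.generation_finite (hreg : G.IsRegular) (n : ℕ) : (G.generation n).Finite := by
  induction n with
  | zero => exact Set.finite_singleton _
  | succ n ih =>
    refine (ih.biUnion fun v _ => hreg.children_finite v).subset fun w hw => ?_
    exact Set.mem_biUnion hw.2 ⟨hw.1, rfl⟩

theorem IsRegular.exists_height_generation (hreg : G.IsRegular) (n : ℕ) :
    ∃ t, ∀ v ∈ G.generation n, G.height v = t := by
  induction n with
  | zero => exact ⟨G.height ⊥, fun v hv => by rw [show v = ⊥ from hv]⟩
  | succ n ih =>
    obtain ⟨t, ht⟩ := ih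
    rcases (G.generation (n + 1)).eq_empty_or_nonempty with h | ⟨w, hw⟩
    · exact ⟨0, fun v hv => by simp [h] at hv⟩
    · refine ⟨G.height w, fun v hv => ?_⟩
      rw [G.height_eq v hv.1, G.height_eq w hw.1, ht _ hv.2, ht _ hw.2,
        hreg.length_eq _ _ ((ht _ hv.2).trans (ht _ hw.2).symm) v ⟨hv.1, rfl⟩ w ⟨hw.1, rfl⟩]

theorem IsRegular.generation_nonempty (hreg : G.IsRegular) (n : ℕ) :
    (G.generation n).Nonempty := by
  induction n with
  | zero => exact ⟨⊥, rfl⟩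
  | succ n ih =>
    obtain ⟨v, hv⟩ := ih
    obtain ⟨w, hw⟩ := hreg.children_nonempty v
    exact ⟨w, hw.1, by rw [hw.2]; exact hv⟩

/-- A decomposition of the edges of a tree into finite layers, the edges in the layer `n` covering
the distances from `τ n` to `τ (n + 1)`. -/
structure Layers (G : RootedMetricTree.{u}) where
  /-- the distance from the root to the lower ends of the edges of a layer -/
  τ : ℕ → ℝ
  /-- the edges of a layer -/
  edges : ℕ → Finset G.Edge
  τ_zero : τ 0 = 0
  strictMono : StrictMono τ
  exists_lt : ∀ R, ∃ n, R < τ n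
  height_pred : ∀ n, ∀ v ∈ edges n, G.height (Order.pred v.1) = τ n
  height_eq : ∀ n, ∀ v ∈ edges n, G.height v.1 = τ (n + 1)
  exists_mem : ∀ v, ∃ n, v ∈ edges n
  nonempty : ∀ n, (edges n).Nonempty
  exists_branching : ∀ n, ∃ b : ℕ, ∀ f : G.tree → ℝ≥0∞,
    ∑ w ∈ edges (n + 1), f (Order.pred w.1) = b * ∑ v ∈ edges n, f v.1

theorem IsRegular.sum_pred_eq (hreg : G.IsRegular) {A B : Finset G.Edge} {t : ℝ}
    (hA : ∀ v ∈ A, G.height v.1 = t)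
    (hB : ∀ w : G.Edge, w ∈ B ↔ ∃ v ∈ A, Order.pred w.1 = v.1) :
    ∃ b : ℕ, ∀ f : G.tree → ℝ≥0∞, ∑ w ∈ B, f (Order.pred w.1) = b * ∑ v ∈ A, f v.1 := by
  classical
  rcases A.eq_empty_or_nonempty with rfl | ⟨v₀, hv₀⟩
  · refine ⟨0, fun f => ?_⟩
    have : B = ∅ := Finset.eq_empty_of_forall_notMem fun w hw => by simpa using (hB w).1 hw
    simp [this]
  refine ⟨(G.branching v₀.1).toNat, fun f => ?_⟩
  set p : G.Edge → G.Edge := fun w =>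
    if h : Order.pred w.1 ≠ ⊥ then ⟨Order.pred w.1, h⟩ else v₀ with hp
  have hpB : ∀ w ∈ B, p w ∈ A ∧ (p w).1 = Order.pred w.1 := by
    intro w hw
    obtain ⟨v, hv, hwv⟩ := (hB w).1 hw
    have h : Order.pred w.1 ≠ ⊥ := hwv ▸ v.2
    have h2 : p w = v := by
      simp only [hp, dif_pos h]
      exact Subtype.ext hwv
    exact ⟨h2 ▸ hv, by rw [h2, hwv]⟩
  rw [← Finset.sum_fiberwise_of_maps_to (fun w hw => (hpB w hw).1), Finset.mul_sum]
  refine Finset.sum_congr rfl fun v hv => ?_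
  have hcard : ((B.filter fun w => p w = v).card : ℕ∞) = G.branching v₀.1 := by
    rw [← hreg.branching_eq v.1 v₀.1 ((hA v hv).trans (hA v₀ hv₀).symm), branching,
      ← Finset.card_map (Function.Embedding.subtype _), ← Set.encard_coe_eq_coe_finsetCard]
    congr 1
    ext w
    simp only [Finset.coe_map, Function.Embedding.subtype_apply, Set.mem_image, Finset.mem_coe,
      Finset.mem_filter, children, Set.mem_ofPred_eq]
    constructor
    · rintro ⟨w, ⟨hw, hwv⟩, rfl⟩
      exact ⟨w.2, by rw [← (hpB w hw).2, hwv]⟩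
    · rintro ⟨hw, hwv⟩
      have hwB : (⟨w, hw⟩ : G.Edge) ∈ B := (hB _).2 ⟨v, hv, hwv⟩
      exact ⟨⟨w, hw⟩, ⟨hwB, Subtype.ext ((hpB _ hwB).2.trans hwv)⟩, rfl⟩
  rw [Finset.sum_congr rfl (g := fun _ => f v.1), Finset.sum_const, nsmul_eq_mul, ← hcard,
    ENat.toNat_natCast]
  intro w hw
  rw [Finset.mem_filter] at hw
  rw [← (hpB w hw.1).2, hw.2]

theorem IsRegular.nonempty_layers (hreg : G.IsRegular) (hheight : G.InfiniteHeight) :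
    Nonempty (Layers G) := by
  choose τ hτ using hreg.exists_height_generation
  have hfin : ∀ n, {v : G.Edge | v.1 ∈ G.generation (n + 1)}.Finite := fun n =>
    (hreg.generation_finite (n + 1)).preimage Subtype.val_injective.injOn
  have hmem : ∀ n v, v ∈ (hfin n).toFinset ↔ v.1 ∈ G.generation (n + 1) := fun n v => by simp
  have hmono : StrictMono τ := strictMono_nat_of_lt_succ fun n => by
    obtain ⟨w, hw⟩ := hreg.generation_nonempty (n + 1)
    rw [← hτ _ _ hw, ← hτ _ _ hw.2]
    exact G.height_pred_lt w hw.1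
  refine ⟨⟨τ, fun n => (hfin n).toFinset, ?_, hmono, fun R => ?_, fun n v hv => ?_,
    fun n v hv => ?_, fun v => ?_, fun n => ?_, fun n => ?_⟩⟩
  · rw [← hτ 0 ⊥ rfl, height_bot]
  · by_contra! hR
    refine hheight ⟨R, ?_⟩
    rintro _ ⟨⟨⟨v, t⟩, hx⟩, rfl⟩
    obtain ⟨n, hn⟩ := exists_mem_generation v
    refine le_trans ?_ (hR n)
    rw [← hτ n v hn]
    rcases hx with hx | hx
    · obtain ⟨rfl, rfl⟩ := Prod.mk.inj hx
      exact (height_bot G).ge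
    · exact hx.2.2
  · exact hτ n _ ((hmem n v).1 hv).2
  · exact hτ (n + 1) _ ((hmem n v).1 hv)
  · obtain ⟨n, hn⟩ := exists_mem_generation v.1
    cases n with
    | zero => exact absurd hn v.2
    | succ n => exact ⟨n, (hmem n v).2 hn⟩
  · obtain ⟨w, hw⟩ := hreg.generation_nonempty (n + 1)
    exact ⟨⟨w, hw.1⟩, (hmem _ _).2 hw⟩
  · refine hreg.sum_pred_eq (t := τ (n + 1)) (fun v hv => hτ _ _ ((hmem n v).1 hv)) fun w => ?_
    rw [hmem]
    constructor
    · rintro ⟨_, hw⟩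
      exact ⟨⟨Order.pred w.1, hw.1⟩, (hmem _ _).2 hw, rfl⟩
    · rintro ⟨v, hv, hwv⟩
      exact ⟨w.2, by rw [hwv]; exact (hmem _ _).1 hv⟩

theorem onEdge_of_mem {α : Type*} (F : G.Point → α) (v : G.Edge) {t : ℝ} (ht : t ∈ G.edgeIoc v.1) :
    onEdge F v t = F ⟨(v.1, t), Or.inr ⟨v.2, ht⟩⟩ := dif_pos ht

theorem onEdge_comp {α β : Type*} (f : α → β) (F : G.Point → α) (v : G.Edge) (t : ℝ) :
    onEdge (fun x => f (F x)) v t = f (onEdge F v t) := by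
  simp only [onEdge, apply_dite f]

theorem onEdge_height {α : Type*} (F : G.Point → α) (v : G.Edge) :
    onEdge F v (G.height v.1) = F (G.vertexPoint v.1) :=
  onEdge_of_mem F v ⟨G.height_pred_lt v.1 v.2, le_rfl⟩

theorem onEdge_height_pred {α : Type*} (F : G.Point → α) (v : G.Edge) :
    onEdge F v (G.height (Order.pred v.1)) = F (G.vertexPoint (Order.pred v.1)) :=
  dif_neg fun h => lt_irrefl _ h.1

theorem onEdge_treeDeriv {𝕜 : Type*} [RCLike 𝕜] (u : G.Point → 𝕜) (v : G.Edge) {t : ℝ}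
    (ht : t ∈ G.edgeIoc v.1) :
    onEdge (treeDeriv u) v t = derivWithin (onEdge u v) (G.edgeIcc v.1) t := by
  rw [onEdge_of_mem _ _ ht]
  exact dif_pos v.2

/-- The sum of the values of a function over the points at a given distance from the root. -/
noncomputable def levelSum (F : G.Point → ℝ≥0∞) (s : ℝ) : ℝ≥0∞ :=
  ∑' v : G.Edge, (G.edgeIoc v.1).indicator (onEdge F v) s

namespace Layers

theorem τ_nonneg (L : Layers G) (n : ℕ) : 0 ≤ L.τ n := L.τ_zero ▸ L.strictMono.monotone n.zero_le

theorem edgeIoc_eq (L : Layers G) {n : ℕ} {v : G.Edge} (hv : v ∈ L.edges n) :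
    G.edgeIoc v.1 = Ioc (L.τ n) (L.τ (n + 1)) := by
  rw [edgeIoc, L.height_pred n v hv, L.height_eq n v hv]

theorem edgeIcc_eq (L : Layers G) {n : ℕ} {v : G.Edge} (hv : v ∈ L.edges n) :
    G.edgeIcc v.1 = Icc (L.τ n) (L.τ (n + 1)) := by
  rw [edgeIcc, L.height_pred n v hv, L.height_eq n v hv]

theorem edgeIoc_subset (L : Layers G) (v : G.Edge) : G.edgeIoc v.1 ⊆ Ioi 0 := by
  obtain ⟨n, hn⟩ := L.exists_mem v
  rw [L.edgeIoc_eq hn]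
  exact fun x hx => (L.τ_nonneg n).trans_lt hx.1

theorem exists_mem_Ioc (L : Layers G) {s : ℝ} (hs : 0 < s) :
    ∃ n, s ∈ Ioc (L.τ n) (L.τ (n + 1)) := by
  classical
  have hex : ∃ n, s ≤ L.τ n := (L.exists_lt s).imp fun _ h => h.le
  have h0 : Nat.find hex ≠ 0 := fun h => by
    have := Nat.find_spec hex
    rw [h, L.τ_zero] at this
    exact this.not_gt hs
  obtain ⟨n, hn⟩ := Nat.exists_eq_succ_of_ne_zero h0
  refine ⟨n, not_le.1 (Nat.find_min hex (by omega)), ?_⟩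
  have := Nat.find_spec hex
  rwa [hn] at this

theorem eq_of_mem_Ioc (L : Layers G) {m n : ℕ} {s : ℝ} (hm : s ∈ Ioc (L.τ m) (L.τ (m + 1)))
    (hn : s ∈ Ioc (L.τ n) (L.τ (n + 1))) : m = n := by
  have h1 := L.strictMono.lt_iff_lt.1 (hm.1.trans_le hn.2)
  have h2 := L.strictMono.lt_iff_lt.1 (hn.1.trans_le hm.2)
  omega

theorem mem_edges_iff (L : Layers G) {n : ℕ} {s : ℝ} (hs : s ∈ Ioc (L.τ n) (L.τ (n + 1)))
    (v : G.Edge) :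
    v ∈ L.edges n ↔ s ∈ G.edgeIoc v.1 := by
  refine ⟨fun hv => L.edgeIoc_eq hv ▸ hs, fun h => ?_⟩
  obtain ⟨m, hm⟩ := L.exists_mem v
  rw [L.edgeIoc_eq hm] at h
  exact L.eq_of_mem_Ioc h hs ▸ hm

theorem levelSum_eq (L : Layers G) {n : ℕ} {s : ℝ} (hs : s ∈ Ioc (L.τ n) (L.τ (n + 1)))
    (F : G.Point → ℝ≥0∞) : levelSum F s = ∑ v ∈ L.edges n, onEdge F v s := by
  rw [levelSum, tsum_eq_sum (s := L.edges n)]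
  · exact Finset.sum_congr rfl fun v hv => indicator_of_mem ((L.mem_edges_iff hs v).1 hv) _
  · exact fun v hv => indicator_of_notMem (fun h => hv ((L.mem_edges_iff hs v).2 h)) _

theorem countable_edge (L : Layers G) : Countable G.Edge := by
  rw [← Set.countable_univ_iff]
  refine (Set.countable_iUnion fun n => (L.edges n).countable_toSet).mono fun v _ => ?_
  obtain ⟨n, hn⟩ := L.exists_mem v
  exact mem_iUnion.2 ⟨n, hn⟩

theorem g₀_eq (L : Layers G) {n : ℕ} {s : ℝ} (hs : s ∈ Ioc (L.τ n) (L.τ (n + 1))) :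
    G.g₀ s = (L.edges n).card := by
  obtain ⟨f, hf⟩ : ∃ f : L.edges n → G.Point, ∀ v, (f v).1 = (v.1.1, s) :=
    ⟨fun v => ⟨(v.1.1, s), Or.inr ⟨v.1.2, (L.mem_edges_iff hs v.1).1 v.2⟩⟩, fun _ => rfl⟩
  have hset : {x : G.Point | x.dist = s} = f '' univ := by
    ext x
    rw [image_univ]
    constructor
    · rintro rfl
      obtain ⟨⟨v, t⟩, hx | hx⟩ := x
      · obtain ⟨rfl, rfl⟩ := Prod.mk.inj hx
        exact absurd hs.1 (L.τ_nonneg n).not_gt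
      · exact ⟨⟨⟨v, hx.1⟩, (L.mem_edges_iff hs _).2 hx.2⟩, Subtype.ext (hf _)⟩
    · rintro ⟨v, rfl⟩
      exact congrArg Prod.snd (hf v)
  have hinj : Function.Injective f := by
    intro v w h
    have h1 := congrArg (fun x : G.Point => x.1.1) h
    simp only [hf] at h1
    exact Subtype.ext (Subtype.ext h1)
  rw [g₀, hset, hinj.encard_image, Set.encard_univ, ENat.card_eq_coe_fintype_card,
    Fintype.card_coe]
  rfl

theorem card_ne_zero (L : Layers G) (n : ℕ) : ((L.edges n).card : ℝ≥0∞) ≠ 0 := by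
  simpa using (L.nonempty n).ne_empty

theorem one_le_g₀ (L : Layers G) {s : ℝ} (hs : 0 < s) : 1 ≤ G.g₀ s := by
  obtain ⟨n, hn⟩ := L.exists_mem_Ioc hs
  rw [L.g₀_eq hn]
  exact_mod_cast (L.nonempty n).card_pos

theorem g₀_ne_top (L : Layers G) {s : ℝ} (hs : 0 < s) : G.g₀ s ≠ ⊤ := by
  obtain ⟨n, hn⟩ := L.exists_mem_Ioc hs
  rw [L.g₀_eq hn]
  exact ENNReal.natCast_ne_top _

theorem iUnion_Ioc (L : Layers G) : ⋃ n, Ioc (L.τ n) (L.τ (n + 1)) = Ioi 0 := by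
  ext s
  simp only [mem_iUnion]
  exact ⟨fun ⟨n, hn⟩ => (L.τ_nonneg n).trans_lt hn.1, L.exists_mem_Ioc⟩

theorem aemeasurable_g₀ (L : Layers G) : AEMeasurable G.g₀ (volume.restrict (Ioi 0)) := by
  rw [← L.iUnion_Ioc, aemeasurable_iUnion_iff]
  intro n
  refine (aemeasurable_const (b := ((L.edges n).card : ℝ≥0∞))).congr ?_
  filter_upwards [ae_restrict_mem measurableSet_Ioc] with s hs
  exact (L.g₀_eq hs).symm

theorem aemeasurable_indicator {F : G.Point → ℝ≥0∞} {v : G.Edge}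
    (hF : AEMeasurable (onEdge F v) (volume.restrict (G.edgeIoc v.1))) :
    AEMeasurable ((G.edgeIoc v.1).indicator (onEdge F v)) (volume.restrict (Ioi 0)) :=
  ((aemeasurable_indicator_iff measurableSet_Ioc).2 hF).mono_measure Measure.restrict_le_self

theorem aemeasurable_levelSum (L : Layers G) {F : G.Point → ℝ≥0∞}
    (hF : ∀ v : G.Edge, AEMeasurable (onEdge F v) (volume.restrict (G.edgeIoc v.1))) :
    AEMeasurable (levelSum F) (volume.restrict (Ioi 0)) := by
  have := L.countable_edge
  exact AEMeasurable.tsum fun v => aemeasurable_indicator (hF v)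

theorem treeIntegral_eq (L : Layers G) {F : G.Point → ℝ≥0∞}
    (hF : ∀ v : G.Edge, AEMeasurable (onEdge F v) (volume.restrict (G.edgeIoc v.1))) :
    treeIntegral F = ∫⁻ s in Ioi 0, levelSum F s := by
  have := L.countable_edge
  simp only [levelSum]
  rw [lintegral_tsum fun v => aemeasurable_indicator (hF v), treeIntegral]
  refine tsum_congr fun v => ?_
  have hm : MeasurableSet (G.edgeIoc v.1) := measurableSet_Ioc
  rw [lintegral_indicator hm, Measure.restrict_restrict hm, inter_eq_left.2 (L.edgeIoc_subset v)]

end Layers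

variable {𝕜 : Type*} [RCLike 𝕜] {u : G.Point → 𝕜}

namespace IsSmoothBounded

theorem continuousOn_derivWithin (hu : IsSmoothBounded u) (v : G.Edge) :
    ContinuousOn (derivWithin (onEdge u v) (G.edgeIcc v.1)) (G.edgeIcc v.1) :=
  (hu.smooth v).continuousOn_derivWithin (uniqueDiffOn_Icc (G.height_pred_lt v.1 v.2)) (by simp)

theorem aemeasurable_onEdge (hu : IsSmoothBounded u) (v : G.Edge) :
    AEMeasurable (onEdge u v) (volume.restrict (G.edgeIoc v.1)) :=
  ((hu.smooth v).continuousOn.mono Ioc_subset_Icc_self).aemeasurable measurableSet_Ioc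

theorem aemeasurable_onEdge_treeDeriv (hu : IsSmoothBounded u) (v : G.Edge) :
    AEMeasurable (onEdge (treeDeriv u) v) (volume.restrict (G.edgeIoc v.1)) := by
  refine (((hu.continuousOn_derivWithin v).mono Ioc_subset_Icc_self).aemeasurable
    measurableSet_Ioc).congr ?_
  filter_upwards [ae_restrict_mem measurableSet_Ioc] with t ht
  exact (onEdge_treeDeriv u v ht).symm

theorem aemeasurable_onEdge_enorm_sq (hu : IsSmoothBounded u) (v : G.Edge) :
    AEMeasurable (onEdge (fun x => ‖u x‖ₑ ^ 2) v) (volume.restrict (G.edgeIoc v.1)) := by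
  refine ((hu.aemeasurable_onEdge v).enorm.pow_const 2).congr
    (Filter.Eventually.of_forall fun t => ?_)
  exact (onEdge_comp (fun z : 𝕜 => ‖z‖ₑ ^ 2) u v t).symm

theorem aemeasurable_onEdge_treeDeriv_enorm_sq (hu : IsSmoothBounded u) (v : G.Edge) :
    AEMeasurable (onEdge (fun x => ‖treeDeriv u x‖ₑ ^ 2) v)
      (volume.restrict (G.edgeIoc v.1)) := by
  refine ((hu.aemeasurable_onEdge_treeDeriv v).enorm.pow_const 2).congr
    (Filter.Eventually.of_forall fun t => ?_)
  exact (onEdge_comp (fun z : 𝕜 => ‖z‖ₑ ^ 2) (treeDeriv u) v t).symm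

theorem aemeasurable_onEdge_enorm_mul (hu : IsSmoothBounded u) (v : G.Edge) :
    AEMeasurable (onEdge (fun x => ‖u x‖ₑ * ‖treeDeriv u x‖ₑ) v)
      (volume.restrict (G.edgeIoc v.1)) := by
  refine ((hu.aemeasurable_onEdge v).enorm.mul (hu.aemeasurable_onEdge_treeDeriv v).enorm).congr
    ?_
  filter_upwards [ae_restrict_mem measurableSet_Ioc] with t ht
  simp only [Pi.mul_apply]
  rw [onEdge_of_mem _ _ ht, onEdge_of_mem _ _ ht, onEdge_of_mem _ _ ht]

theorem aemeasurable_onEdge_weight (hu : IsSmoothBounded u) (L : Layers G) {ψ : ℝ → ℝ}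
    (hψm : AEMeasurable ψ (volume.restrict (Ioi 0))) (v : G.Edge) :
    AEMeasurable (onEdge (fun x => ENNReal.ofReal (ψ x.dist) * ‖u x‖ₑ ^ 2) v)
      (volume.restrict (G.edgeIoc v.1)) := by
  refine ((hψm.ennreal_ofReal.mono_measure
    (Measure.restrict_mono (L.edgeIoc_subset v) le_rfl)).mul
    (hu.aemeasurable_onEdge_enorm_sq v)).congr ?_
  filter_upwards [ae_restrict_mem measurableSet_Ioc] with t ht
  simp only [Pi.mul_apply]
  rw [onEdge_of_mem _ _ ht, onEdge_of_mem _ _ ht]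
  rfl

end IsSmoothBounded

theorem levelSum_eq_zero {F : G.Point → ℝ≥0∞} {s : ℝ} (hF : ∀ x : G.Point, x.dist = s → F x = 0) :
    levelSum F s = 0 := by
  rw [levelSum, ENNReal.tsum_eq_zero]
  intro v
  by_cases hs : s ∈ G.edgeIoc v.1
  · rw [indicator_of_mem hs, onEdge_of_mem _ _ hs]
    exact hF _ rfl
  · exact indicator_of_notMem hs _

theorem levelSum_dist_mul (c : ℝ → ℝ≥0∞) (F : G.Point → ℝ≥0∞) (s : ℝ) :
    levelSum (fun x => c x.dist * F x) s = c s * levelSum F s := by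
  rw [levelSum, levelSum, ← ENNReal.tsum_mul_left]
  refine tsum_congr fun v => ?_
  by_cases hs : s ∈ G.edgeIoc v.1
  · rw [indicator_of_mem hs, indicator_of_mem hs, onEdge_of_mem _ _ hs, onEdge_of_mem _ _ hs]
    rfl
  · rw [indicator_of_notMem hs, indicator_of_notMem hs, mul_zero]

namespace Layers

theorem treeIntegral_enorm_sq_ne_top (L : Layers G) (hu : IsSmoothBounded u) :
    treeIntegral (fun x => ‖u x‖ₑ ^ 2) ≠ ⊤ := by
  classical
  obtain ⟨R, hR⟩ := hu.bounded_support
  obtain ⟨m, hm⟩ := L.exists_lt R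
  rw [treeIntegral, tsum_eq_sum (s := (Finset.range m).biUnion L.edges)]
  · refine ENNReal.sum_ne_top.2 fun v _ => ?_
    have hc : ContinuousOn (fun t => ‖onEdge u v t‖ ^ 2) (G.edgeIcc v.1) :=
      (hu.smooth v).continuousOn.norm.pow 2
    have hi : IntegrableOn (fun t => ‖onEdge u v t‖ ^ 2) (G.edgeIoc v.1) :=
      hc.integrableOn_Icc.mono_set Ioc_subset_Icc_self
    refine ne_of_eq_of_ne (lintegral_congr fun t => ?_) hi.lintegral_lt_top.ne
    rw [onEdge_comp (fun z : 𝕜 => ‖z‖ₑ ^ 2) u v t, ENNReal.ofReal_pow (norm_nonneg _), ofReal_norm]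
  · intro v hv
    obtain ⟨n, hn⟩ := L.exists_mem v
    have hnm : m ≤ n := by
      by_contra! h
      exact hv (Finset.mem_biUnion.2 ⟨n, Finset.mem_range.2 h, hn⟩)
    refine (setLIntegral_congr_fun measurableSet_Ioc fun t ht => ?_).trans lintegral_zero
    rw [onEdge_of_mem _ _ ht]
    by_contra h
    have h1 := hR ⟨(v.1, t), Or.inr ⟨v.2, ht⟩⟩ fun h0 => h (by simp [h0])
    change t ≤ R at h1
    have h2 : G.height (Order.pred v.1) < t := ht.1
    rw [L.height_pred n v hn] at h2
    linarith [L.strictMono.monotone hnm]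

/-- The mean value of `|u|²` over the upper ends of the edges in a layer. -/
noncomputable def meanSq (L : Layers G) (u : G.Point → 𝕜) (n : ℕ) : ℝ≥0∞ :=
  ((L.edges n).card : ℝ≥0∞)⁻¹ * ∑ v ∈ L.edges n, ‖u (G.vertexPoint v.1)‖ₑ ^ 2

theorem mean_le_meanSq_add (L : Layers G) (hu : IsSmoothBounded u) {n : ℕ} {t : ℝ}
    (ht : t ∈ Icc (L.τ n) (L.τ (n + 1))) :
    ((L.edges n).card : ℝ≥0∞)⁻¹ * ∑ v ∈ L.edges n, ‖onEdge u v t‖ₑ ^ 2 ≤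
      L.meanSq u n + ∫⁻ s in Ioc t (L.τ (n + 1)),
        2 * levelSum (fun x => ‖u x‖ₑ * ‖treeDeriv u x‖ₑ) s * (G.g₀ s)⁻¹ := by
  have hsub : ∀ v ∈ L.edges n, Ioc t (L.τ (n + 1)) ⊆ G.edgeIoc v.1 := fun v hv => by
    rw [L.edgeIoc_eq hv]
    exact Ioc_subset_Ioc_left ht.1
  have h1 : ∫⁻ s in Ioc t (L.τ (n + 1)),
        2 * levelSum (fun x => ‖u x‖ₑ * ‖treeDeriv u x‖ₑ) s * (G.g₀ s)⁻¹ =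
      ((L.edges n).card : ℝ≥0∞)⁻¹ * ∑ v ∈ L.edges n, ∫⁻ s in Ioc t (L.τ (n + 1)),
        2 * onEdge (fun x => ‖u x‖ₑ * ‖treeDeriv u x‖ₑ) v s := by
    rw [← lintegral_finsetSum' _ fun v hv => ((hu.aemeasurable_onEdge_enorm_mul v).mono_measure
      (Measure.restrict_mono (hsub v hv) le_rfl)).const_mul 2,
      ← lintegral_const_mul' _ _ (ENNReal.inv_ne_top.2 (L.card_ne_zero n))]
    refine setLIntegral_congr_fun measurableSet_Ioc fun s hs => ?_
    have hs' := Ioc_subset_Ioc_left ht.1 hs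
    simp only [L.levelSum_eq hs', L.g₀_eq hs', ← Finset.mul_sum]
    ring
  rw [h1, meanSq, ← mul_add, ← Finset.sum_add_distrib]
  gcongr with v hv
  have h2 := enorm_sq_le_add_setLIntegral (hu.smooth v) (G.height_pred_lt v.1 v.2)
    (t := t) (by rw [← edgeIcc, L.edgeIcc_eq hv]; exact ht)
  rw [onEdge_height, L.height_eq n v hv] at h2
  refine h2.trans (add_le_add_right (le_of_eq ?_) _)
  refine setLIntegral_congr_fun measurableSet_Ioc fun s hs => ?_
  have hs' := hsub v hv hs
  rw [onEdge_of_mem (fun x => ‖u x‖ₑ * ‖treeDeriv u x‖ₑ) _ hs', ← onEdge_of_mem u _ hs',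
    ← onEdge_of_mem (treeDeriv u) _ hs', onEdge_treeDeriv u v hs', ← L.height_eq n v hv]
  rfl

theorem meanSq_eq_succ (L : Layers G) (u : G.Point → 𝕜) (n : ℕ) :
    L.meanSq u n = ((L.edges (n + 1)).card : ℝ≥0∞)⁻¹ *
      ∑ v ∈ L.edges (n + 1), ‖onEdge u v (L.τ (n + 1))‖ₑ ^ 2 := by
  obtain ⟨b, hb⟩ := L.exists_branching n
  have hcard : ((L.edges (n + 1)).card : ℝ≥0∞) = b * (L.edges n).card := by
    simpa using hb fun _ => 1
  have hb0 : (b : ℝ≥0∞) ≠ 0 := fun h => L.card_ne_zero (n + 1) (by rw [hcard, h, zero_mul])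
  have hsum : ∑ v ∈ L.edges (n + 1), ‖onEdge u v (L.τ (n + 1))‖ₑ ^ 2 =
      b * ∑ v ∈ L.edges n, ‖u (G.vertexPoint v.1)‖ₑ ^ 2 := by
    rw [← hb fun v => ‖u (G.vertexPoint v)‖ₑ ^ 2]
    refine Finset.sum_congr rfl fun v hv => ?_
    rw [← L.height_pred _ v hv, onEdge_height_pred]
  rw [hsum, hcard, meanSq, ENNReal.mul_inv (Or.inl hb0) (Or.inl (ENNReal.natCast_ne_top _)),
    mul_mul_mul_comm, ENNReal.inv_mul_cancel hb0 (ENNReal.natCast_ne_top _), one_mul]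

theorem meanSq_le (L : Layers G) (hu : IsSmoothBounded u) (n : ℕ) :
    L.meanSq u n ≤ ∫⁻ s in Ioi (L.τ (n + 1)),
      2 * levelSum (fun x => ‖u x‖ₑ * ‖treeDeriv u x‖ₑ) s * (G.g₀ s)⁻¹ := by
  set f : ℝ → ℝ≥0∞ := fun s =>
    2 * levelSum (fun x => ‖u x‖ₑ * ‖treeDeriv u x‖ₑ) s * (G.g₀ s)⁻¹
  have hstep : ∀ k, L.meanSq u n ≤
      L.meanSq u (n + k) + ∫⁻ s in Ioc (L.τ (n + 1)) (L.τ (n + k + 1)), f s := by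
    intro k
    induction k with
    | zero => simp
    | succ k ih =>
      refine ih.trans ?_
      have h1 := L.mean_le_meanSq_add hu (n := n + k + 1)
        (left_mem_Icc.2 (L.strictMono.monotone (Nat.le_succ _)))
      rw [← meanSq_eq_succ] at h1
      refine (add_le_add_left h1 _).trans (le_of_eq ?_)
      rw [add_assoc, add_comm (lintegral _ _), ← lintegral_union measurableSet_Ioc,
        Ioc_union_Ioc_eq_Ioc (L.strictMono.monotone (by omega))
          (L.strictMono.monotone (by omega))]
      · rfl
      · exact Set.disjoint_left.2 fun x hx hx' => not_lt_of_ge hx.2 hx'.1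
  obtain ⟨R, hR⟩ := hu.bounded_support
  obtain ⟨m, hm⟩ := L.exists_lt R
  have h0 : L.meanSq u (n + m) = 0 := by
    rw [meanSq, Finset.sum_eq_zero, mul_zero]
    intro v hv
    by_contra h
    have h1 : G.height v.1 ≤ R := hR (G.vertexPoint v.1) fun h0 => h (by simp [h0])
    rw [L.height_eq _ v hv] at h1
    linarith [L.strictMono.monotone (show m ≤ n + m + 1 by omega)]
  refine (hstep m).trans ?_
  rw [h0, zero_add]
  exact lintegral_mono_set Ioc_subset_Ioi_self

theorem inv_g₀_mul_levelSum_le (L : Layers G) (hu : IsSmoothBounded u) {t : ℝ} (ht : 0 < t) :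
    (G.g₀ t)⁻¹ * levelSum (fun x => ‖u x‖ₑ ^ 2) t ≤ ∫⁻ s in Ioi t,
      2 * levelSum (fun x => ‖u x‖ₑ * ‖treeDeriv u x‖ₑ) s * (G.g₀ s)⁻¹ := by
  obtain ⟨n, hn⟩ := L.exists_mem_Ioc ht
  have h1 := L.mean_le_meanSq_add hu (Ioc_subset_Icc_self hn)
  have h2 : levelSum (fun x => ‖u x‖ₑ ^ 2) t = ∑ v ∈ L.edges n, ‖onEdge u v t‖ₑ ^ 2 := by
    rw [L.levelSum_eq hn]
    exact Finset.sum_congr rfl fun v _ => onEdge_comp (fun z : 𝕜 => ‖z‖ₑ ^ 2) u v t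
  rw [L.g₀_eq hn, h2]
  refine h1.trans ((add_le_add_left (L.meanSq_le hu n) _).trans (le_of_eq ?_))
  rw [add_comm, ← lintegral_union measurableSet_Ioi, Ioc_union_Ioi_eq_Ioi hn.2]
  exact Set.disjoint_left.2 fun x hx hx' => not_lt_of_ge hx.2 hx'

theorem lintegral_inv_g₀_ne_zero (L : Layers G) (s : ℝ) : ∫⁻ t in Ioi s, (G.g₀ t)⁻¹ ≠ 0 := by
  obtain ⟨n, hn⟩ := L.exists_lt s
  have hlt := L.strictMono n.lt_succ_self
  have h1 : ∫⁻ t in Ioc (L.τ n) (L.τ (n + 1)), (G.g₀ t)⁻¹ =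
      ((L.edges n).card : ℝ≥0∞)⁻¹ * ENNReal.ofReal (L.τ (n + 1) - L.τ n) := by
    rw [← Real.volume_Ioc, ← setLIntegral_const]
    exact setLIntegral_congr_fun measurableSet_Ioc fun t ht => by simp only [L.g₀_eq ht]
  have h2 : ∫⁻ t in Ioc (L.τ n) (L.τ (n + 1)), (G.g₀ t)⁻¹ ≠ 0 := by
    rw [h1]
    exact mul_ne_zero (ENNReal.inv_ne_zero.2 (ENNReal.natCast_ne_top _))
      (ENNReal.ofReal_pos.2 (sub_pos.2 hlt)).ne'
  exact fun h => h2 (le_antisymm (h ▸ lintegral_mono_set fun x hx => hn.trans hx.1) bot_le)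

theorem two_mul_levelSum_mul_le (u : G.Point → 𝕜) (t : ℝ) (c : ℝ≥0∞) :
    2 * levelSum (fun x => ‖u x‖ₑ * ‖treeDeriv u x‖ₑ) t * c ≤
      2⁻¹ * (levelSum (fun x => ‖u x‖ₑ ^ 2) t * c ^ 2) +
        2 * levelSum (fun x => ‖treeDeriv u x‖ₑ ^ 2) t := by
  have key : ∀ a b c : ℝ≥0∞, 2 * (a * b) * c ≤ 2⁻¹ * (a ^ 2 * c ^ 2) + 2 * b ^ 2 := by
    intro a b c
    rw [← mul_pow, show 2 * (a * b) * c = 2 * (a * c * b) by ring]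
    generalize a * c = x
    rcases eq_or_ne x ⊤ with rfl | hx
    · simp
    rcases eq_or_ne b ⊤ with rfl | hb
    · simp
    lift x to ℝ≥0 using hx
    lift b to ℝ≥0 using hb
    have h : 2 * (x * b) ≤ 2⁻¹ * x ^ 2 + 2 * b ^ 2 := by
      rw [← NNReal.coe_le_coe]
      push_cast
      nlinarith [sq_nonneg ((x : ℝ) - 2 * b)]
    rw [← ENNReal.coe_ofNat, ← ENNReal.coe_inv two_ne_zero]
    exact_mod_cast h
  simp only [levelSum]
  rw [← ENNReal.tsum_mul_left, ← ENNReal.tsum_mul_right, ← ENNReal.tsum_mul_right,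
    ← ENNReal.tsum_mul_left, ← ENNReal.tsum_mul_left, ← ENNReal.tsum_add]
  refine ENNReal.tsum_le_tsum fun v => ?_
  by_cases hs : t ∈ G.edgeIoc v.1
  · simp only [indicator_of_mem hs, onEdge_of_mem _ _ hs]
    exact key _ _ _
  · simp [indicator_of_notMem hs]

end Layers

theorem hardyInequality_of_four_mul_M_le (L : Layers G) (hred : G.reducedHeight < ⊤) {ψ : ℝ → ℝ}
    (hψm : AEMeasurable ψ (volume.restrict (Set.Ioi 0))) {C : ℝ≥0} (hC : 4 * G.M ψ ≤ C) :
    G.HardyInequality 𝕜 ψ C := by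
  intro u hu
  have hg := L.aemeasurable_g₀
  have hψm' : AEMeasurable (fun t => ENNReal.ofReal (ψ t)) (volume.restrict (Ioi 0)) :=
    hψm.ennreal_ofReal
  have hQ := L.aemeasurable_levelSum hu.aemeasurable_onEdge_enorm_sq
  have hF := hu.aemeasurable_onEdge_weight L hψm
  obtain ⟨R, hR⟩ := hu.bounded_support
  rw [L.treeIntegral_eq hF, L.treeIntegral_eq hu.aemeasurable_onEdge_treeDeriv_enorm_sq]
  refine le_trans (le_of_eq ?_) ((lintegral_mul_le_of_muckenhoupt (M := G.M ψ) hg.inv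
    (hψm'.mul hg) (L.aemeasurable_levelSum hu.aemeasurable_onEdge_enorm_mul) hQ
    hred.ne (fun s _ => L.lintegral_inv_g₀_ne_zero s)
    (fun t ht => L.inv_g₀_mul_levelSum_le hu ht)
    (fun t _ c => Layers.two_mul_levelSum_mul_le u t c) ?_
    (fun t ht => le_iSup₂ (f := fun t (_ : t ∈ Ioi (0 : ℝ)) =>
      (∫⁻ s in Ioc 0 t, ENNReal.ofReal (ψ s) * G.g₀ s) * ∫⁻ s in Ioi t, (G.g₀ s)⁻¹) t ht)).trans
    (mul_le_mul_left hC _))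
  · refine setLIntegral_congr_fun measurableSet_Ioi fun s (hs : 0 < s) => ?_
    have h1 := L.one_le_g₀ hs
    simp only [Pi.mul_apply, Pi.inv_apply]
    rw [levelSum_dist_mul (fun t => ENNReal.ofReal (ψ t)), mul_assoc, ← mul_assoc (G.g₀ s),
      ENNReal.mul_inv_cancel (one_pos.trans_le h1).ne' (L.g₀_ne_top hs), one_mul]
  · set T := max R 1
    have hT : 0 < T := lt_max_of_lt_right one_pos
    set c := ((∫⁻ r in Ioi T, (G.g₀ r)⁻¹)⁻¹) ^ 2 with hc
    have hc' : c ≠ ⊤ := ENNReal.pow_ne_top (ENNReal.inv_ne_top.2 (L.lintegral_inv_g₀_ne_zero T))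
    refine ne_top_of_le_ne_top (ENNReal.mul_ne_top (L.treeIntegral_enorm_sq_ne_top hu) hc') ?_
    rw [L.treeIntegral_eq hu.aemeasurable_onEdge_enorm_sq, ← lintegral_mul_const'' _ hQ]
    refine setLIntegral_mono' measurableSet_Ioi fun s (hs : 0 < s) => ?_
    rcases le_or_gt s T with hsT | hsT
    · simp only [Pi.inv_apply, hc]
      gcongr
      calc (G.g₀ s)⁻¹ * (∫⁻ r in Ioi s, (G.g₀ r)⁻¹)⁻¹
          ≤ 1 * (∫⁻ r in Ioi s, (G.g₀ r)⁻¹)⁻¹ := by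
            gcongr
            exact ENNReal.inv_le_one.2 (L.one_le_g₀ hs)
        _ ≤ _ := by
          rw [one_mul]
          exact ENNReal.inv_le_inv.2 (lintegral_mono_set (Ioi_subset_Ioi hsT))
    · rw [levelSum_eq_zero, zero_mul]
      · exact zero_le
      · intro x hx
        by_contra h
        have := hR x fun h0 => h (by simp [h0])
        linarith [le_max_left R 1]

end RootedMetricTree

/-- Smooth cut-off functions on an interval. -/
theorem exists_contDiff_cutoff {a b c d : ℝ} (hab : a < b) (hcd : c < d) :
    ∃ η : ℝ → ℝ, ContDiff ℝ ∞ η ∧ (∀ s, 0 ≤ η s) ∧ (∀ s, η s ≤ 1) ∧ (∀ s ≤ a, η s = 0) ∧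
      (∀ s, d ≤ s → η s = 0) ∧ ∀ s ∈ Icc b c, η s = 1 := by
  refine ⟨fun s => Real.smoothTransition ((s - a) / (b - a)) *
    Real.smoothTransition ((d - s) / (d - c)), ?_, fun s => ?_, fun s => ?_, fun s hs => ?_,
    fun s hs => ?_, fun s hs => ?_⟩
  · exact (Real.smoothTransition.contDiff.comp ((contDiff_id.sub contDiff_const).div_const _)).mul
      (Real.smoothTransition.contDiff.comp ((contDiff_const.sub contDiff_id).div_const _))
  · exact mul_nonneg (Real.smoothTransition.nonneg _) (Real.smoothTransition.nonneg _)
  · exact mul_le_one₀ (Real.smoothTransition.le_one _) (Real.smoothTransition.nonneg _)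
      (Real.smoothTransition.le_one _)
  · beta_reduce
    rw [Real.smoothTransition.zero_of_nonpos, zero_mul]
    exact div_nonpos_of_nonpos_of_nonneg (by linarith) (by linarith)
  · beta_reduce
    rw [mul_comm, Real.smoothTransition.zero_of_nonpos, zero_mul]
    exact div_nonpos_of_nonpos_of_nonneg (by linarith) (by linarith)
  · beta_reduce
    rw [Real.smoothTransition.one_of_one_le, Real.smoothTransition.one_of_one_le, one_mul]
    · rw [one_le_div (by linarith)]; linarith [hs.2]
    · rw [one_le_div (by linarith)]; linarith [hs.1]

theorem hasDerivAt_intervalIntegral_of_continuous {η : ℝ → ℝ} (hη : Continuous η) (a t : ℝ) :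
    HasDerivAt (fun t => ∫ s in a..t, η s) (η t) t :=
  hη.integral_hasStrictDerivAt a t |>.hasDerivAt

theorem ContDiff.intervalIntegral_infty {η : ℝ → ℝ} (hη : ContDiff ℝ ∞ η) (a : ℝ) :
    ContDiff ℝ ∞ fun t => ∫ s in a..t, η s := by
  have hd := hasDerivAt_intervalIntegral_of_continuous hη.continuous a
  rw [contDiff_infty_iff_deriv]
  refine ⟨fun t => (hd t).differentiableAt, ?_⟩
  rwa [show deriv (fun t => ∫ s in a..t, η s) = η from funext fun t => (hd t).deriv]

namespace RootedMetricTree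

variable {G : RootedMetricTree.{u}} {𝕜 : Type*} [RCLike 𝕜]

/-- The primitive of `-η / g₀` vanishing at `T`. -/
noncomputable def radialPrimitive (G : RootedMetricTree.{u}) (η : ℝ → ℝ) (T t : ℝ) : ℝ :=
  ∫ s in t..T, η s * ((G.g₀ s)⁻¹).toReal

namespace Layers

theorem aemeasurable_toReal_inv_g₀ (L : Layers G) :
    AEMeasurable (fun s => ((G.g₀ s)⁻¹).toReal) (volume.restrict (Ioi 0)) :=
  L.aemeasurable_g₀.inv.ennreal_toReal

theorem integrableOn_mul_inv_g₀ (L : Layers G) {η : ℝ → ℝ} (hη : Continuous η) {b : ℝ} :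
    IntegrableOn (fun s => η s * ((G.g₀ s)⁻¹).toReal) (Ioc 0 b) := by
  have h1 : IntegrableOn η (Ioc 0 b) := hη.integrableOn_Ioc
  refine h1.mul_bdd (c := 1) ((L.aemeasurable_toReal_inv_g₀.mono_measure
    (Measure.restrict_mono Ioc_subset_Ioi_self le_rfl)).aestronglyMeasurable) ?_
  filter_upwards [ae_restrict_mem measurableSet_Ioc] with s hs
  rw [Real.norm_of_nonneg ENNReal.toReal_nonneg]
  exact ENNReal.toReal_le_of_le_ofReal zero_le_one
    (by simpa using ENNReal.inv_le_one.2 (L.one_le_g₀ hs.1))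

theorem intervalIntegrable_mul_inv_g₀ (L : Layers G) {η : ℝ → ℝ} (hη : Continuous η) {a b : ℝ}
    (ha : 0 ≤ a) (hb : 0 ≤ b) :
    IntervalIntegrable (fun s => η s * ((G.g₀ s)⁻¹).toReal) volume a b := by
  have h : ∀ {c : ℝ}, 0 ≤ c →
      IntervalIntegrable (fun s => η s * ((G.g₀ s)⁻¹).toReal) volume 0 c := fun hc =>
    (intervalIntegrable_iff_integrableOn_Ioc_of_le hc).2 (L.integrableOn_mul_inv_g₀ hη)
  exact (h ha).symm.trans (h hb)

theorem radialPrimitive_eq_const_add (L : Layers G) {η : ℝ → ℝ} (hη : Continuous η) {T : ℝ}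
    (hT : 0 ≤ T) {n : ℕ} {t : ℝ} (ht : t ∈ Icc (L.τ n) (L.τ (n + 1))) :
    G.radialPrimitive η T t = G.radialPrimitive η T (L.τ n) -
      ((L.edges n).card : ℝ)⁻¹ * ∫ s in (L.τ n)..t, η s := by
  have h0 := L.τ_nonneg n
  have ht0 := h0.trans ht.1
  have h1 : ∫ s in (L.τ n)..t, η s * ((G.g₀ s)⁻¹).toReal =
      ((L.edges n).card : ℝ)⁻¹ * ∫ s in (L.τ n)..t, η s := by
    rw [← intervalIntegral.integral_const_mul]
    refine intervalIntegral.integral_congr_ae (Filter.Eventually.of_forall fun s hs => ?_)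
    rw [uIoc_of_le ht.1] at hs
    rw [L.g₀_eq ⟨hs.1, hs.2.trans ht.2⟩, mul_comm]
    simp
  rw [← h1, radialPrimitive, radialPrimitive, eq_sub_iff_add_eq, add_comm,
    intervalIntegral.integral_add_adjacent_intervals
      (L.intervalIntegrable_mul_inv_g₀ hη h0 ht0) (L.intervalIntegrable_mul_inv_g₀ hη ht0 hT)]

theorem onEdge_radial {α : Type*} (L : Layers G) (f : ℝ → α) {n : ℕ} {v : G.Edge}
    (hv : v ∈ L.edges n) {t : ℝ} (ht : t ∈ Icc (L.τ n) (L.τ (n + 1))) :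
    onEdge (fun x => f x.dist) v t = f t := by
  rcases eq_or_lt_of_le ht.1 with h | h
  · rw [← h, ← L.height_pred n v hv]
    exact onEdge_height_pred _ _
  · exact onEdge_of_mem _ _ (L.edgeIoc_eq hv ▸ ⟨h, ht.2⟩)

theorem isSmoothBounded_radial (L : Layers G) {η : ℝ → ℝ} (hη : ContDiff ℝ ∞ η) {T : ℝ}
    (hT : 0 ≤ T) (hηT : ∀ s, T ≤ s → η s = 0) :
    IsSmoothBounded fun x : G.Point => ((G.radialPrimitive η T x.dist : ℝ) : 𝕜) := by
  constructor
  · intro v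
    obtain ⟨n, hn⟩ := L.exists_mem v
    rw [L.edgeIcc_eq hn]
    have hc : ContDiff ℝ ∞ fun t => ((G.radialPrimitive η T (L.τ n) -
        ((L.edges n).card : ℝ)⁻¹ * ∫ s in (L.τ n)..t, η s : ℝ) : 𝕜) :=
      (RCLike.ofRealCLM (K := 𝕜)).contDiff.comp
        (contDiff_const.sub (contDiff_const.mul (hη.intervalIntegral_infty _)))
    refine hc.contDiffOn.congr fun t ht => ?_
    rw [L.onEdge_radial (fun t => ((G.radialPrimitive η T t : ℝ) : 𝕜)) hn ht,
      L.radialPrimitive_eq_const_add hη.continuous hT ht]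
  · refine ⟨T, fun x hx => ?_⟩
    by_contra! h
    refine hx ?_
    rw [radialPrimitive, intervalIntegral.integral_congr (g := fun _ => 0)]
    · simp
    · intro s hs
      rw [uIcc_of_ge h.le] at hs
      simp only [hηT s hs.1, zero_mul]

theorem onEdge_treeDeriv_radial (L : Layers G) {η : ℝ → ℝ} (hη : Continuous η) {T : ℝ}
    (hT : 0 ≤ T) {n : ℕ} {v : G.Edge} (hv : v ∈ L.edges n) {t : ℝ}
    (ht : t ∈ Ioc (L.τ n) (L.τ (n + 1))) :
    onEdge (treeDeriv fun x : G.Point => ((G.radialPrimitive η T x.dist : ℝ) : 𝕜)) v t =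
      ((-(((L.edges n).card : ℝ)⁻¹ * η t) : ℝ) : 𝕜) := by
  rw [onEdge_treeDeriv _ _ (L.edgeIoc_eq hv ▸ ht), L.edgeIcc_eq hv]
  have ht' := Ioc_subset_Icc_self ht
  have hd := ((RCLike.ofRealCLM (K := 𝕜)).hasFDerivAt.comp_hasDerivAt t
    (((hasDerivAt_intervalIntegral_of_continuous hη (L.τ n) t).const_mul
      ((L.edges n).card : ℝ)⁻¹).const_sub (G.radialPrimitive η T (L.τ n)))).hasDerivWithinAt
        (s := Icc (L.τ n) (L.τ (n + 1)))
  refine (hd.congr (fun s hs => ?_) ?_).derivWithin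
    (uniqueDiffOn_Icc (L.strictMono n.lt_succ_self) t ht')
  · rw [L.onEdge_radial (fun t => ((G.radialPrimitive η T t : ℝ) : 𝕜)) hv hs,
      L.radialPrimitive_eq_const_add hη hT hs]
    rfl
  · rw [L.onEdge_radial (fun t => ((G.radialPrimitive η T t : ℝ) : 𝕜)) hv ht',
      L.radialPrimitive_eq_const_add hη hT ht']
    rfl

theorem levelSum_radial (L : Layers G) (f : ℝ → ℝ≥0∞) {s : ℝ} (hs : 0 < s) :
    levelSum (G := G) (fun x => f x.dist) s = G.g₀ s * f s := by
  obtain ⟨n, hn⟩ := L.exists_mem_Ioc hs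
  rw [L.levelSum_eq hn, L.g₀_eq hn,
    Finset.sum_congr rfl fun v hv => L.onEdge_radial f hv (Ioc_subset_Icc_self hn),
    Finset.sum_const, nsmul_eq_mul]

theorem levelSum_treeDeriv_radial_le (L : Layers G) {η : ℝ → ℝ} (hη : Continuous η)
    (h0 : ∀ s, 0 ≤ η s) (h1 : ∀ s, η s ≤ 1) {T : ℝ} (hT : 0 ≤ T) {s : ℝ} (hs : 0 < s) :
    levelSum (fun x => ‖treeDeriv (fun x : G.Point =>
      ((G.radialPrimitive η T x.dist : ℝ) : 𝕜)) x‖ₑ ^ 2) s ≤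
        ENNReal.ofReal (η s * ((G.g₀ s)⁻¹).toReal) := by
  obtain ⟨n, hn⟩ := L.exists_mem_Ioc hs
  have hN : (0 : ℝ) < (L.edges n).card := by exact_mod_cast (L.nonempty n).card_pos
  have h2 : ∀ v ∈ L.edges n, onEdge (fun x => ‖treeDeriv (fun x : G.Point =>
      ((G.radialPrimitive η T x.dist : ℝ) : 𝕜)) x‖ₑ ^ 2) v s =
        ENNReal.ofReal ((((L.edges n).card : ℝ)⁻¹ * η s) ^ 2) := by
    intro v hv
    rw [onEdge_comp (fun z : 𝕜 => ‖z‖ₑ ^ 2), L.onEdge_treeDeriv_radial hη hT hv hn, ← ofReal_norm,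
      RCLike.norm_ofReal, ← ENNReal.ofReal_pow (abs_nonneg _), sq_abs, neg_sq]
  rw [L.levelSum_eq hn, L.g₀_eq hn, Finset.sum_congr rfl h2, Finset.sum_const, nsmul_eq_mul,
    ← ENNReal.ofReal_natCast, ← ENNReal.ofReal_mul hN.le]
  refine ENNReal.ofReal_le_ofReal ?_
  rw [← ENNReal.ofReal_inv_of_pos hN, ENNReal.toReal_ofReal (by positivity)]
  calc _ = η s * (η s * ((L.edges n).card : ℝ)⁻¹) := by field_simp
    _ ≤ 1 * (η s * ((L.edges n).card : ℝ)⁻¹) := by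
      gcongr
      · exact mul_nonneg (h0 s) (by positivity)
      · exact h1 s
    _ = _ := one_mul _

end Layers

/-- The Hardy inequality for radial test functions. -/
theorem HardyInequality.mul_radialPrimitive_le (L : Layers G) {ψ : ℝ → ℝ}
    (hψm : AEMeasurable ψ (volume.restrict (Set.Ioi 0))) {C : ℝ≥0} (hC : G.HardyInequality 𝕜 ψ C)
    {η : ℝ → ℝ} (hη : ContDiff ℝ ∞ η) (h0 : ∀ s, 0 ≤ η s) (h1 : ∀ s, η s ≤ 1)
    {a T : ℝ} (ha : 0 < a) (haT : a ≤ T) (hηa : ∀ s ≤ a, η s = 0) (hηT : ∀ s, T ≤ s → η s = 0) :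
    (∫⁻ s in Ioc 0 a, ENNReal.ofReal (ψ s) * G.g₀ s) *
      ENNReal.ofReal (G.radialPrimitive η T 0) ≤ C := by
  have hT : 0 < T := ha.trans_le haT
  have hηc := hη.continuous
  set u : G.Point → 𝕜 := fun x => ((G.radialPrimitive η T x.dist : ℝ) : 𝕜) with hu_def
  have hu : IsSmoothBounded u := L.isSmoothBounded_radial hη hT.le hηT
  set A := G.radialPrimitive η T 0 with hA
  have hA0 : 0 ≤ A := intervalIntegral.integral_nonneg hT.le fun s _ =>
    mul_nonneg (h0 s) ENNReal.toReal_nonneg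
  have hφ : ∀ s ∈ Ioc 0 a, G.radialPrimitive η T s = A := by
    intro s hs
    rw [hA, radialPrimitive, radialPrimitive, ← intervalIntegral.integral_add_adjacent_intervals
      (L.intervalIntegrable_mul_inv_g₀ hηc le_rfl hs.1.le)
      (L.intervalIntegrable_mul_inv_g₀ hηc hs.1.le hT.le),
      intervalIntegral.integral_congr (a := 0) (b := s) (g := fun _ => 0)]
    · simp
    · intro r hr
      rw [uIcc_of_le hs.1.le] at hr
      simp only [hηa r (hr.2.trans hs.2), zero_mul]
  have hupper : treeIntegral (fun x => ‖treeDeriv u x‖ₑ ^ 2) ≤ ENNReal.ofReal A := by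
    rw [L.treeIntegral_eq hu.aemeasurable_onEdge_treeDeriv_enorm_sq, hA, radialPrimitive,
      intervalIntegral.integral_of_le hT.le, ofReal_integral_eq_lintegral_ofReal
        (L.integrableOn_mul_inv_g₀ hηc)
        (Filter.Eventually.of_forall fun s => mul_nonneg (h0 s) ENNReal.toReal_nonneg),
      ← lintegral_indicator measurableSet_Ioc, ← lintegral_indicator measurableSet_Ioi]
    refine lintegral_mono fun s => ?_
    by_cases hs : 0 < s
    · rw [indicator_of_mem (show s ∈ Ioi 0 from hs)]
      refine (L.levelSum_treeDeriv_radial_le hηc h0 h1 hT.le hs).trans ?_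
      rcases le_or_gt s T with hsT | hsT
      · rw [indicator_of_mem (show s ∈ Ioc 0 T from ⟨hs, hsT⟩)]
      · rw [hηT s hsT.le]
        simp
    · rw [indicator_of_notMem (show s ∉ Ioi 0 from hs)]
      exact zero_le
  have hlower : (∫⁻ s in Ioc 0 a, ENNReal.ofReal (ψ s) * G.g₀ s) * ENNReal.ofReal A ^ 2 ≤
      treeIntegral (fun x => ENNReal.ofReal (ψ x.dist) * ‖u x‖ₑ ^ 2) := by
    rw [L.treeIntegral_eq (hu.aemeasurable_onEdge_weight L hψm),
      ← lintegral_mul_const' _ _ (by finiteness)]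
    refine le_trans (le_of_eq ?_) (lintegral_mono_set
      (show Ioc 0 a ⊆ Ioi 0 from Ioc_subset_Ioi_self))
    refine setLIntegral_congr_fun measurableSet_Ioc fun s hs => ?_
    have h2 := L.levelSum_radial
      (fun t => ENNReal.ofReal (ψ t) * ‖((G.radialPrimitive η T t : ℝ) : 𝕜)‖ₑ ^ 2) hs.1
    rw [hφ s hs, ← ofReal_norm, RCLike.norm_ofReal, abs_of_nonneg hA0] at h2
    simp only [hu_def]
    rw [h2]
    ring
  rcases eq_or_ne (ENNReal.ofReal A) 0 with hA00 | hA00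
  · rw [hA00, mul_zero]
    exact zero_le
  have h3 := (hlower.trans (hC u hu)).trans (mul_le_mul_right hupper _)
  rw [sq, ← mul_assoc] at h3
  exact (ENNReal.mul_le_mul_iff_left hA00 ENNReal.ofReal_ne_top).1 h3

theorem HardyInequality.M_le (L : Layers G) {ψ : ℝ → ℝ}
    (hψm : AEMeasurable ψ (volume.restrict (Set.Ioi 0))) {C : ℝ≥0}
    (hC : G.HardyInequality 𝕜 ψ C) : G.M ψ ≤ C := by
  refine iSup₂_le fun a (ha : 0 < a) => ?_
  have hU : Ioi a = ⋃ k : ℕ, Ioc (a + 1 / (k + 1)) (a + 1 + k) := by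
    ext s
    simp only [mem_Ioi, mem_iUnion, mem_Ioc]
    constructor
    · intro hs
      obtain ⟨k, hk⟩ := exists_nat_one_div_lt (sub_pos.2 hs)
      obtain ⟨m, hm⟩ := exists_nat_ge (s - a - 1)
      refine ⟨max k m, ?_, ?_⟩
      · have : 1 / (((max k m : ℕ) : ℝ) + 1) ≤ 1 / ((k : ℝ) + 1) :=
          one_div_le_one_div_of_le (by positivity) (by simp)
        linarith
      · have : (m : ℝ) ≤ ((max k m : ℕ) : ℝ) := by simp
        linarith
    · rintro ⟨k, hk, -⟩
      have : (0 : ℝ) < 1 / ((k : ℝ) + 1) := by positivity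
      linarith
  have hdir : Directed (· ⊆ ·) fun k : ℕ => Ioc (a + 1 / ((k : ℝ) + 1)) (a + 1 + k) :=
    Monotone.directed_le fun k m hkm => by
      have : (k : ℝ) ≤ m := by exact_mod_cast hkm
      refine Ioc_subset_Ioc ?_ (by linarith)
      gcongr
  rw [hU, setLIntegral_iUnion_of_directed _ hdir, ENNReal.mul_iSup]
  refine iSup_le fun k => ?_
  have hk : (0 : ℝ) < 1 / ((k : ℝ) + 1) := by positivity
  obtain ⟨η, hη, h0, h1, hηa, hηT, hη1⟩ := exists_contDiff_cutoff (a := a)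
    (b := a + 1 / ((k : ℝ) + 1)) (c := a + 1 + k) (d := a + 2 + k) (by linarith) (by linarith)
  have hT : a ≤ a + 2 + k := by linarith [(Nat.cast_nonneg k : (0 : ℝ) ≤ k)]
  refine le_trans ?_ (hC.mul_radialPrimitive_le L hψm hη h0 h1 ha hT hηa hηT)
  gcongr
  rw [radialPrimitive, intervalIntegral.integral_of_le (ha.le.trans hT),
    ofReal_integral_eq_lintegral_ofReal (L.integrableOn_mul_inv_g₀ hη.continuous)
      (Filter.Eventually.of_forall fun s => mul_nonneg (h0 s) ENNReal.toReal_nonneg)]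
  refine le_trans (le_of_eq ?_) (lintegral_mono_set (s := Ioc (a + 1 / ((k : ℝ) + 1)) (a + 1 + k))
    (Ioc_subset_Ioc (by linarith) (by linarith)))
  refine setLIntegral_congr_fun measurableSet_Ioc fun s hs => ?_
  have hs0 : 0 < s := by linarith [hs.1]
  rw [hη1 s (Ioc_subset_Icc_self hs), one_mul, ENNReal.ofReal_toReal]
  exact ENNReal.inv_ne_top.2 (one_pos.trans_le (L.one_le_g₀ hs0)).ne'

end RootedMetricTree

theorem mainTheorem1 (𝕜 : Type*) [RCLike 𝕜] (G : RootedMetricTree.{u})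
    (hreg : G.IsRegular) (hheight : G.InfiniteHeight) (hred : G.reducedHeight < ⊤)
    (ψ : ℝ → ℝ) (hψm : AEMeasurable ψ (volume.restrict (Set.Ioi 0)))
    (hψ : ∀ t, 0 < t → 0 ≤ ψ t) :
    ((∃ C : ℝ≥0, G.HardyInequality 𝕜 ψ C) ↔ G.M ψ < ⊤) ∧
      (G.M ψ < ⊤ → ∃ C : ℝ≥0, IsLeast {C : ℝ≥0 | G.HardyInequality 𝕜 ψ C} C ∧
        G.M ψ ≤ C ∧ (C : ℝ≥0∞) ≤ 4 * G.M ψ) := by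
  obtain ⟨L⟩ := hreg.nonempty_layers hheight
  have hnec : ∀ C : ℝ≥0, G.HardyInequality 𝕜 ψ C → G.M ψ ≤ C := fun C hC => hC.M_le L hψm
  have hsuff : G.M ψ < ⊤ → G.HardyInequality 𝕜 ψ (4 * G.M ψ).toNNReal := fun hM =>
    RootedMetricTree.hardyInequality_of_four_mul_M_le L hred hψm
      (ENNReal.coe_toNNReal (ENNReal.mul_ne_top (by simp) hM.ne)).ge
  refine ⟨⟨fun ⟨C, hC⟩ => (hnec C hC).trans_lt ENNReal.coe_lt_top, fun hM => ⟨_, hsuff hM⟩⟩,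
    fun hM => ?_⟩
  set S := {C : ℝ≥0 | G.HardyInequality 𝕜 ψ C}
  have hS : S.Nonempty := ⟨_, hsuff hM⟩
  have h4 : (4 * G.M ψ).toNNReal ∈ S := hsuff hM
  have h4' : ((4 * G.M ψ).toNNReal : ℝ≥0∞) = 4 * G.M ψ :=
    ENNReal.coe_toNNReal (ENNReal.mul_ne_top (by simp) hM.ne)
  have hle : (sInf S : ℝ≥0) ≤ (4 * G.M ψ).toNNReal := csInf_le (OrderBot.bddBelow S) h4
  have hMle : G.M ψ ≤ (sInf S : ℝ≥0) := by
    rw [← ENNReal.coe_toNNReal hM.ne, ENNReal.coe_le_coe]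
    exact le_csInf hS fun C hC => by
      rw [← ENNReal.coe_le_coe, ENNReal.coe_toNNReal hM.ne]
      exact hnec C hC
  have hmem : sInf S ∈ S := by
    rcases eq_or_ne (sInf S) 0 with h0 | h0
    · have hM0 : G.M ψ = 0 := by simpa [h0] using hMle
      have : (4 * G.M ψ).toNNReal = sInf S := by rw [hM0, h0]; simp
      exact this ▸ h4
    · intro u hu
      have h0' : ∀ C ∈ S, (C : ℝ≥0∞) ≠ 0 := fun C hC => by
        exact_mod_cast ((pos_iff_ne_zero.2 h0).trans_le (csInf_le (OrderBot.bddBelow S) hC)).ne'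
      rw [← ENNReal.div_le_iff_le_mul (Or.inr ENNReal.coe_ne_top) (Or.inr (by exact_mod_cast h0)),
        ENNReal.coe_sInf hS]
      refine le_iInf₂ fun C hC => ?_
      rw [ENNReal.div_le_iff_le_mul (Or.inr ENNReal.coe_ne_top) (Or.inr (h0' C hC))]
      exact hC u hu
  refine ⟨sInf S, ⟨hmem, fun C hC => csInf_le (OrderBot.bddBelow S) hC⟩, hMle, ?_⟩
  rw [← h4']
  exact_mod_cast hle
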